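/- Let $G$ be a finite complete multipartite graph with at least two (non-empty) parts. That is, $G$ is a finite simple graph whose vertex set is partitioned into at least two non-empty parts such that two vertices are adjacent if and only if they lie in different parts. Let $n$, $m$ and $\Delta(G)$ denote its number of vertices, number of edges and maximum degree. Call $G$ \emph{overfull} if $n$ is odd and $m > \frac{1}{2}\Delta(G)(n-1)$. Let $prc(G)$, the \emph{proper rainbow connection number} of $G$, be the smallest number $k$ for which there is an edge-colouring of $G$ with colours from $\{1,\dots,k\}$ such that edges with a common end-vertex always receive different colours and any two vertices are joined by a rainbow path, i.e. a path whose edges have pairwise different colours. If $G$ is overfull, then $$prc(G)=\Delta(G)+1;$$ otherwise, $$prc(G)=\Delta(G).$$ -/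

import Mathlib

namespace SimpleGraph

/-- A walk is a rainbow path for the edge-colouring `c` if it is a path
and its edges have pairwise different colours. -/
def IsRainbowPath {V : Type*} {G : SimpleGraph V} {K : Type*} (c : G.edgeSet → K)
    {u v : V} (p : G.Walk u v) : Prop :=
  p.IsPath ∧ ∀ e f : G.edgeSet, (e : Sym2 V) ∈ p.edges → (f : Sym2 V) ∈ p.edges →
    c e = c f → e = f

/-- An edge-colouring is proper if any two different edges with a common end-vertex
receive different colours. -/
def IsProperEdgeColouring {V : Type*} {G : SimpleGraph V} {K : Type*}
    (c : G.edgeSet → K) : Prop :=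
  ∀ e f : G.edgeSet, e ≠ f → (∃ v : V, v ∈ (e : Sym2 V) ∧ v ∈ (f : Sym2 V)) → c e ≠ c f

/-- The edge-colouring `c` makes `G` properly rainbow connected: it is proper and any two
vertices are connected by a rainbow path. -/
def IsProperlyRainbowConnected {V : Type*} {G : SimpleGraph V} {K : Type*}
    (c : G.edgeSet → K) : Prop :=
  IsProperEdgeColouring c ∧ ∀ u v : V, ∃ p : G.Walk u v, IsRainbowPath c p

/-- The proper rainbow connection number: the smallest number of colours in an edge-colouring
which makes `G` properly rainbow connected. For a finite connected graph the set below is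
non-empty; for a disconnected graph it is empty and the value is the default `0`. -/
noncomputable def prc {V : Type*} (G : SimpleGraph V) : ℕ :=
  sInf {k : ℕ | ∃ c : G.edgeSet → Fin k, IsProperlyRainbowConnected c}

/-- A finite graph with `n` vertices and `m` edges is overfull if `n` is odd and
`m > Δ(G) (n - 1) / 2`. -/
def IsOverfull {V : Type*} [Fintype V] [DecidableEq V] (G : SimpleGraph V)
    [DecidableRel G.Adj] : Prop :=
  Odd (Fintype.card V) ∧
    (G.edgeFinset.card : ℚ) > 1 / 2 * (G.maxDegree : ℚ) * ((Fintype.card V : ℚ) - 1)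

end SimpleGraph

/-! Two non-adjacent vertices of a complete multipartite graph with an edge have a common neighbour,
and a path of two edges is rainbow in every proper colouring. So `prc` is the chromatic index, and
the claim becomes that overfullness is the only obstruction to Δ colours. The lower bounds are the
degree at a vertex and, for odd n, the fact that a colour class has at most (n - 1)/2 edges.

The colourings come from amalgamation and detachment. Contract each part to one vertex x of weight w
x, its size; if there are at least two universal vertices, these are contracted together as well and
produce loops. A proper k-colouring of G becomes a colouring of this multigraph in which every
colour has degree at most w x at x. Conversely, such a colouring can be pulled apart one vertex at a
time, each step being a balanced splitting of a bipartite multigraph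
(`IsAmalgamColouring.exists_update`).

To colour the contracted multigraph, orient it so that x has out-degree at most k r x and in-degree
at most k s x, where r x + s x = w x (`exists_capacity_orientation`). Read as a bipartite multigraph
from tails to heads, it splits into k pieces of capacities r and s
(`exists_capacity_decomposition`); forgetting directions gives degrees at most w x. Hall's theorem
supplies the orientation. When n is odd the weights cannot all be halved, and the imbalance must be
paid for by a total degree deficiency nk - 2m of at least k: this is exactly non-overfullness.

The argument needs all weights to be at least 2. A single universal vertex is therefore treated
separately, by duplicating it or by embedding G in a complete graph. -/

section

open Finset

/-! ### Decomposing integer matrices: Birkhoff, König and capacities -/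

/-- A square matrix of natural numbers with constant positive row and column sums supports a
permutation. -/
theorem exists_perm_pos_of_regular {X : Type*} [Fintype X] [DecidableEq X] (M : X → X → ℕ)
    {k : ℕ} (hk : 0 < k) (hr : ∀ i, ∑ j, M i j = k) (hc : ∀ j, ∑ i, M i j = k) :
    ∃ σ : Equiv.Perm X, ∀ i, 0 < M i (σ i) := by
  have hall : ∀ S : Finset X,
      S.card ≤ (S.biUnion fun i => univ.filter fun j => 0 < M i j).card := by
    intro S
    set N := S.biUnion fun i => univ.filter fun j => 0 < M i j with hN
    have h1 : ∑ i ∈ S, ∑ j ∈ N, M i j = S.card * k := by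
      rw [← smul_eq_mul, ← Finset.sum_const]
      refine Finset.sum_congr rfl fun i hi => ?_
      rw [← hr i]
      refine Finset.sum_subset (Finset.subset_univ _) fun j _ hj => ?_
      by_contra h
      exact hj (Finset.mem_biUnion.2 ⟨i, hi, by simpa using Nat.pos_of_ne_zero h⟩)
    have h2 : ∑ i ∈ S, ∑ j ∈ N, M i j ≤ N.card * k := by
      rw [Finset.sum_comm, ← smul_eq_mul, ← Finset.sum_const]
      refine Finset.sum_le_sum fun j _ => ?_
      rw [← hc j]
      exact Finset.sum_le_sum_of_subset (Finset.subset_univ _)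
    exact Nat.le_of_mul_le_mul_right (h1 ▸ h2) hk
  obtain ⟨f, hf, hf'⟩ := (Finset.all_card_le_biUnion_card_iff_exists_injective _).1 hall
  refine ⟨Equiv.ofBijective f (Finite.injective_iff_bijective.1 hf), fun i => ?_⟩
  simpa using hf' i

/-- A square matrix of natural numbers with all row and column sums equal to `k` is a sum of `k`
permutation matrices. -/
theorem exists_perm_decomposition {X : Type*} [Fintype X] [DecidableEq X] (k : ℕ) :
    ∀ M : X → X → ℕ, (∀ i, ∑ j, M i j = k) → (∀ j, ∑ i, M i j = k) →
      ∃ σ : Fin k → Equiv.Perm X, ∀ i j, ∑ c, (if σ c i = j then 1 else 0) = M i j := by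
  induction k with
  | zero =>
    intro M hr _
    refine ⟨fun _ => 1, fun i j => ?_⟩
    have := hr i
    rw [Finset.sum_eq_zero_iff] at this
    simp [this j (mem_univ j)]
  | succ k ih =>
    intro M hr hc
    obtain ⟨τ, hτ⟩ := exists_perm_pos_of_regular M (Nat.succ_pos k) hr hc
    have hle : ∀ i j, (if τ i = j then 1 else 0) ≤ M i j := by
      intro i j
      split_ifs with h
      · exact h ▸ hτ i
      · exact Nat.zero_le _
    obtain ⟨σ, hσ⟩ := ih (fun i j => M i j - if τ i = j then 1 else 0)
      (fun i => by
        rw [Finset.sum_tsub_distrib _ fun j _ => hle i j, hr i]; simp)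
      (fun j => by
        rw [Finset.sum_tsub_distrib _ fun i _ => hle i j, hc j]
        have : ∑ i, (if τ i = j then 1 else 0) = 1 := by
          rw [Finset.sum_eq_single (τ.symm j)]
          · simp
          · intro b _ hb
            rw [if_neg]
            rintro rfl
            simp at hb
          · simp
        rw [this]; simp)
    refine ⟨Fin.cons τ σ, fun i j => ?_⟩
    rw [Fin.sum_univ_succ]
    simp only [Fin.cons_zero, Fin.cons_succ]
    rw [hσ, Nat.add_sub_cancel' (hle i j)]

/-- König's edge-colouring theorem for bipartite multigraphs, in matrix form. -/
theorem exists_matching_decomposition {I J : Type*} [Fintype I] [Fintype J] (k : ℕ)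
    (F : I → J → ℕ) (hr : ∀ i, ∑ j, F i j ≤ k) (hc : ∀ j, ∑ i, F i j ≤ k) :
    ∃ f : Fin k → I → J → ℕ, (∀ i j, ∑ c, f c i j = F i j) ∧
      (∀ c i, ∑ j, f c i j ≤ 1) ∧ ∀ c j, ∑ i, f c i j ≤ 1 := by
  classical
  -- `F` and its transpose form the off-diagonal blocks; the diagonal blocks absorb the deficits, so
  -- all row and column sums are `k`.
  let M : I ⊕ J → I ⊕ J → ℕ := fun x y => match x, y with
    | .inl i, .inl i' => if i = i' then k - ∑ j, F i j else 0
    | .inl i, .inr j => F i j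
    | .inr j, .inl i => F i j
    | .inr j, .inr j' => if j = j' then k - ∑ i, F i j else 0
  obtain ⟨σ, hσ⟩ := exists_perm_decomposition k M
    (by
      rintro (i | j)
      · simp [M, hr i]
      · simp [M, hc j])
    (by
      rintro (i | j)
      · simp [M, hr i]
      · simp [M, hc j])
  refine ⟨fun c i j => if σ c (.inl i) = .inr j then 1 else 0, fun i j => hσ _ _,
    fun c i => ?_, fun c j => ?_⟩
  · rw [Finset.sum_boole, Nat.cast_id, Finset.card_le_one]
    intro a ha b hb
    simp only [mem_filter, mem_univ, true_and] at ha hb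
    exact Sum.inr_injective (ha.symm.trans hb)
  · rw [Finset.sum_boole, Nat.cast_id, Finset.card_le_one]
    intro a ha b hb
    simp only [mem_filter, mem_univ, true_and] at ha hb
    exact Sum.inl_injective ((σ c).injective (ha.trans hb.symm))

theorem exists_le_sum_eq {J : Type*} [Fintype J] (v : J → ℕ) (m : ℕ) (hm : m ≤ ∑ j, v j) :
    ∃ u : J → ℕ, (∀ j, u j ≤ v j) ∧ ∑ j, u j = m := by
  classical
  induction m with
  | zero => exact ⟨0, by simp, by simp⟩
  | succ m ih =>
    obtain ⟨u, hu, hs⟩ := ih (by omega)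
    obtain ⟨j, -, hj⟩ : ∃ j ∈ univ, u j < v j := Finset.exists_lt_of_sum_lt (by omega)
    refine ⟨Function.update u j (u j + 1), fun i => ?_, ?_⟩
    · by_cases h : i = j
      · subst h; simpa using hj
      · simpa [h] using hu i
    · rw [Finset.sum_update_of_mem (mem_univ j)]
      have := Finset.add_sum_erase univ u (mem_univ j)
      rw [Finset.sdiff_singleton_eq_erase]
      omega

theorem exists_split_of_sum_le_mul {J : Type*} [Fintype J] (k r : ℕ) :
    ∀ v : J → ℕ, ∑ j, v j ≤ k * r →
      ∃ u : Fin r → J → ℕ, (∀ j, ∑ t, u t j = v j) ∧ ∀ t, ∑ j, u t j ≤ k := by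
  induction r with
  | zero =>
    intro v hv
    refine ⟨fun _ => 0, fun j => ?_, fun t => t.elim0⟩
    have : ∑ j, v j = 0 := by omega
    rw [Finset.sum_eq_zero_iff] at this
    simp [this j (mem_univ j)]
  | succ r ih =>
    intro v hv
    obtain ⟨u, hu, hs⟩ := exists_le_sum_eq v (min k (∑ j, v j)) (min_le_right _ _)
    obtain ⟨w, hw, hw'⟩ := ih (fun j => v j - u j) (by
      rw [Finset.sum_tsub_distrib _ fun j _ => hu j, hs]
      rw [Nat.mul_succ] at hv
      omega)
    refine ⟨Fin.cons u w, fun j => ?_, fun t => ?_⟩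
    · rw [Fin.sum_univ_succ]
      simp only [Fin.cons_zero, Fin.cons_succ]
      rw [hw, Nat.add_sub_cancel' (hu j)]
    · refine Fin.cases ?_ (fun t => ?_) t
      · simp [hs]
      · simpa using hw' t

/-- A matrix of natural numbers whose row and column sums are at most `k` times given capacities
is a sum of `k` matrices obeying these capacities. -/
theorem exists_capacity_decomposition {I J : Type*} [Fintype I] [Fintype J] (k : ℕ)
    (F : I → J → ℕ) (r : I → ℕ) (s : J → ℕ) (hr : ∀ i, ∑ j, F i j ≤ k * r i)
    (hc : ∀ j, ∑ i, F i j ≤ k * s j) :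
    ∃ f : Fin k → I → J → ℕ, (∀ i j, ∑ c, f c i j = F i j) ∧
      (∀ c i, ∑ j, f c i j ≤ r i) ∧ ∀ c j, ∑ i, f c i j ≤ s j := by
  -- Row `i` is split into `r i` rows and column `j` into `s j` columns, all of sum at most `k`.
  -- König's theorem applies to the split matrix, and merging the copies again turns the bounds 1
  -- into `r i` and `s j`.
  choose u hu hu' using fun i => exists_split_of_sum_le_mul k (r i) (F i) (hr i)
  have hcol : ∀ j, ∑ x : (Σ i, Fin (r i)), u x.1 x.2 j ≤ k * s j := by
    intro j
    rw [Fintype.sum_sigma]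
    simpa [hu] using hc j
  choose w hw hw' using fun j => exists_split_of_sum_le_mul k (s j)
    (fun x : (Σ i, Fin (r i)) => u x.1 x.2 j) (hcol j)
  obtain ⟨g, hg, hgr, hgc⟩ := exists_matching_decomposition k
    (fun (x : Σ i, Fin (r i)) (y : Σ j, Fin (s j)) => w y.1 y.2 x)
    (fun x => by
      rw [Fintype.sum_sigma]
      simpa [hw] using hu' x.1 x.2)
    (fun y => hw' y.1 y.2)
  refine ⟨fun c i j => ∑ a, ∑ b, g c ⟨i, a⟩ ⟨j, b⟩, fun i j => ?_, fun c i => ?_, fun c j => ?_⟩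
  · rw [Finset.sum_comm]
    simp_rw [Finset.sum_comm (s := (univ : Finset (Fin k))), hg, hw, hu]
  · rw [Finset.sum_comm]
    calc ∑ a, ∑ j, ∑ b, g c ⟨i, a⟩ ⟨j, b⟩ ≤ ∑ a : Fin (r i), 1 := by
          refine Finset.sum_le_sum fun a _ => ?_
          rw [← Fintype.sum_sigma (fun y : (Σ j, Fin (s j)) => g c ⟨i, a⟩ y)]
          exact hgr c ⟨i, a⟩
      _ = r i := by simp
  · calc ∑ i, ∑ a, ∑ b, g c ⟨i, a⟩ ⟨j, b⟩ = ∑ b, ∑ i, ∑ a, g c ⟨i, a⟩ ⟨j, b⟩ := by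
          rw [Finset.sum_comm]
          simp_rw [Finset.sum_comm (s := (univ : Finset (Fin (s j))))]
      _ ≤ ∑ b : Fin (s j), 1 := by
          refine Finset.sum_le_sum fun b _ => ?_
          rw [← Fintype.sum_sigma (fun x : (Σ i, Fin (r i)) => g c x ⟨j, b⟩)]
          exact hgc c ⟨j, b⟩
      _ = s j := by simp

/-! ### Amalgamations along twin fibres and their detachment -/

namespace SimpleGraph

/-- Vertices in the same fibre of `ρ` have the same neighbours apart from themselves. -/
def HasTwinFibres {V : Type*} (G : SimpleGraph V) (ρ : V → V) : Prop :=
  ∀ u v z, ρ u = ρ v → z ≠ u → z ≠ v → (G.Adj u z ↔ G.Adj v z)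

theorem HasTwinFibres.update {V : Type*} [DecidableEq V] {G : SimpleGraph V} {ρ : V → V}
    (h : G.HasTwinFibres ρ) (hρ : ∀ v, ρ (ρ v) = ρ v)
    {v₀ : V} (hv₀ : ρ v₀ ≠ v₀) : G.HasTwinFibres (Function.update ρ v₀ v₀) := by
  have hunused : ∀ u, ρ u ≠ v₀ := fun u hu => hv₀ (hu ▸ hρ u)
  intro u v z huv hzu hzv
  by_cases hu : u = v₀
  · by_cases hv : v = v₀
    · rw [hu, hv]
    · rw [hu, Function.update_self, Function.update_of_ne hv] at huv
      exact absurd huv.symm (hunused v)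
  · by_cases hv : v = v₀
    · rw [hv, Function.update_self, Function.update_of_ne hu] at huv
      exact absurd huv (hunused u)
    · rw [Function.update_of_ne hu, Function.update_of_ne hv] at huv
      exact h u v z huv hzu hzv

variable {V : Type*} [Fintype V] [DecidableEq V]

/-- The number of ordered pairs of adjacent vertices lying in the fibres of `ρ` over `x`
and `y`. -/
def pairCount (G : SimpleGraph V) [DecidableRel G.Adj] (ρ : V → V) (x y : V) : ℕ :=
  ∑ u, ∑ v, if ρ u = x ∧ ρ v = y ∧ G.Adj u v then 1 else 0

/-- `m c x y` counts the edges of colour `c` between the amalgamated vertices `x` and `y`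
(loops are counted twice) in an edge-colouring of the amalgamation of `G` along `ρ`, in which
every colour has degree at most the size of the fibre at each amalgamated vertex. -/
structure IsAmalgamColouring (G : SimpleGraph V) [DecidableRel G.Adj] (ρ : V → V) {k : ℕ}
    (m : Fin k → V → V → ℕ) : Prop where
  symm : ∀ c x y, m c x y = m c y x
  even : ∀ c x, Even (m c x x)
  total : ∀ x y, ∑ c, m c x y = G.pairCount ρ x y
  row : ∀ c x, ∑ y, m c x y ≤ (univ.filter fun v => ρ v = x).card

variable {G : SimpleGraph V} [DecidableRel G.Adj]

/-- Swapping the twins `u` and `v` is a bijection between the two neighbour sets; the swap is needed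
because `u` and `v` may be adjacent. -/
theorem HasTwinFibres.card_eq {ρ : V → V} (h : G.HasTwinFibres ρ) {u v : V} (huv : ρ u = ρ v)
    (y : V) : (univ.filter fun z => ρ z = y ∧ G.Adj u z).card =
      (univ.filter fun z => ρ z = y ∧ G.Adj v z).card := by
  refine Finset.card_bij (fun z _ => Equiv.swap u v z) ?_
    (fun _ _ _ _ hab => (Equiv.swap u v).injective hab) ?_
  · intro z hz
    simp only [mem_filter, mem_univ, true_and] at hz ⊢
    by_cases h1 : z = u
    · subst h1; exact absurd hz.2 (G.loopless.irrefl _)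
    by_cases h2 : z = v
    · subst h2
      rw [Equiv.swap_apply_right]
      exact ⟨huv.trans hz.1, hz.2.symm⟩
    · rw [Equiv.swap_apply_of_ne_of_ne h1 h2]
      exact ⟨hz.1, (h u v z huv h1 h2).1 hz.2⟩
  · intro z hz
    simp only [mem_filter, mem_univ, true_and] at hz
    refine ⟨Equiv.swap u v z, ?_, Equiv.swap_apply_self u v z⟩
    simp only [mem_filter, mem_univ, true_and]
    by_cases h2 : z = v
    · subst h2; exact absurd hz.2 (G.loopless.irrefl _)
    by_cases h1 : z = u
    · subst h1
      rw [Equiv.swap_apply_left]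
      exact ⟨huv.symm.trans hz.1, hz.2.symm⟩
    · rw [Equiv.swap_apply_of_ne_of_ne h1 h2]
      exact ⟨hz.1, (h u v z huv h1 h2).2 hz.2⟩

theorem pairCount_eq_sum (ρ : V → V) (x y : V) : G.pairCount ρ x y =
    ∑ v ∈ univ.filter (fun v => ρ v = x), (univ.filter fun z => ρ z = y ∧ G.Adj v z).card := by
  unfold pairCount
  rw [Finset.sum_filter]
  refine Finset.sum_congr rfl fun u _ => ?_
  split_ifs with h
  · rw [Finset.card_filter]
    simp [h]
  · simp [h]

/-- Divisibility by the fibre size is what lets each vertex of a fibre take an exact equal share of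
the edges when it is split off. -/
theorem HasTwinFibres.pairCount_eq {ρ : V → V} (h : G.HasTwinFibres ρ) (v y : V) :
    G.pairCount ρ (ρ v) y = (univ.filter fun u => ρ u = ρ v).card *
      (univ.filter fun z => ρ z = y ∧ G.Adj v z).card := by
  rw [pairCount_eq_sum, ← smul_eq_mul, ← Finset.sum_const]
  refine Finset.sum_congr rfl fun u hu => h.card_eq ?_ y
  simpa using hu

/-- How the number of adjacent pairs between fibres changes when a vertex leaves its fibre. -/
theorem pairCount_update (ρ : V → V) (v₀ a b : V) :
    G.pairCount (Function.update ρ v₀ v₀) a b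
      + ((if a = ρ v₀ then (univ.filter fun z => ρ z = b ∧ G.Adj v₀ z).card else 0)
        + if b = ρ v₀ then (univ.filter fun z => ρ z = a ∧ G.Adj v₀ z).card else 0)
      = G.pairCount ρ a b
      + ((if a = v₀ then (univ.filter fun z => ρ z = b ∧ G.Adj v₀ z).card else 0)
        + if b = v₀ then (univ.filter fun z => ρ z = a ∧ G.Adj v₀ z).card else 0) := by
  let P : V → V → ℤ := fun u a => if ρ u = a then 1 else 0
  let A : V → V → ℤ := fun u v => if G.Adj u v then 1 else 0
  let d : V → ℤ := fun a => (if a = v₀ then 1 else 0) - (if a = ρ v₀ then 1 else 0)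
  let D : V → ℤ := fun u => if u = v₀ then 1 else 0
  have hA : ∀ u v, A u v = A v u := fun u v => by simp only [A, G.adj_comm u v]
  have hA0 : A v₀ v₀ = 0 := by simp [A]
  have h1 : ∀ a b, (G.pairCount ρ a b : ℤ) = ∑ u, ∑ v, P u a * P v b * A u v := by
    intro a b
    unfold pairCount
    push_cast
    refine Finset.sum_congr rfl fun u _ => Finset.sum_congr rfl fun v _ => ?_
    simp only [P, A]
    split_ifs <;> simp_all
  -- Moving `v₀` perturbs the fibre indicator by the rank-one term `D u * d a`. The count is
  -- bilinear in the indicator, and the quadratic term of the expansion vanishes because `v₀` is not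
  -- adjacent to itself.
  have hP' : ∀ u a, (if Function.update ρ v₀ v₀ u = a then (1 : ℤ) else 0)
      = P u a + D u * d a := by
    intro u a
    by_cases hu : u = v₀
    · subst hu
      simp only [Function.update_self, P, D, d, if_true, eq_comm (a := a)]
      ring
    · simp [P, D, hu]
  have h2 : (G.pairCount (Function.update ρ v₀ v₀) a b : ℤ)
      = ∑ u, ∑ v, (P u a + D u * d a) * (P v b + D v * d b) * A u v := by
    unfold pairCount
    push_cast
    refine Finset.sum_congr rfl fun u _ => Finset.sum_congr rfl fun v _ => ?_
    rw [← hP', ← hP']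
    simp only [A]
    split_ifs <;> simp_all
  have ht : ∀ b, (((univ.filter fun z => ρ z = b ∧ G.Adj v₀ z).card : ℕ) : ℤ)
      = ∑ v, P v b * A v₀ v := by
    intro b
    rw [Finset.card_filter]
    push_cast
    refine Finset.sum_congr rfl fun v _ => ?_
    simp only [P, A]
    split_ifs <;> simp_all
  have h3 : (G.pairCount (Function.update ρ v₀ v₀) a b : ℤ) = G.pairCount ρ a b
      + d a * (∑ v, P v b * A v₀ v) + d b * ∑ v, P v a * A v₀ v := by
    rw [h2, h1]
    have e : ∀ u v, (P u a + D u * d a) * (P v b + D v * d b) * A u v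
        = P u a * P v b * A u v + D u * (d a * (P v b * A u v))
          + D v * (d b * (P u a * A v u)) + D u * (D v * (d a * d b * A u v)) := by
      intro u v
      rw [hA v u]; ring
    simp_rw [e, Finset.sum_add_distrib]
    have s1 : ∑ u, ∑ v, D u * (d a * (P v b * A u v)) = d a * ∑ v, P v b * A v₀ v := by
      rw [Finset.sum_eq_single v₀]
      · simp [D, Finset.mul_sum]
      · intro u _ hu; simp [D, hu]
      · simp
    have s2 : ∑ u, ∑ v, D v * (d b * (P u a * A v u)) = d b * ∑ v, P v a * A v₀ v := by
      rw [Finset.sum_comm, Finset.sum_eq_single v₀]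
      · simp [D, Finset.mul_sum]
      · intro u _ hu; simp [D, hu]
      · simp
    have s3 : ∑ u, ∑ v, D u * (D v * (d a * d b * A u v)) = 0 := by
      refine Finset.sum_eq_zero fun u _ => Finset.sum_eq_zero fun v _ => ?_
      by_cases hu : u = v₀
      · by_cases hv : v = v₀
        · rw [hu, hv, hA0]; ring
        · simp [D, hv]
      · simp [D, hu]
    rw [s1, s2, s3]; ring
  rw [← ht, ← ht] at h3
  zify
  rw [h3]
  simp only [d]
  split_ifs <;> ring

/-- A vertex can be split off from its fibre. -/
theorem IsAmalgamColouring.exists_update {ρ : V → V} {k : ℕ} {m : Fin k → V → V → ℕ}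
    (hm : G.IsAmalgamColouring ρ m) (h : G.HasTwinFibres ρ) (hρ : ∀ v, ρ (ρ v) = ρ v)
    {v₀ : V} (hv₀ : ρ v₀ ≠ v₀) :
    ∃ m' : Fin k → V → V → ℕ, G.IsAmalgamColouring (Function.update ρ v₀ v₀) m' := by
  have hunused : ∀ u, ρ u ≠ v₀ := fun u hu => hv₀ (hu ▸ hρ u)
  set x := ρ v₀ with hx
  set w := (univ.filter fun v => ρ v = x).card with hw
  let t : V → ℕ := fun y => (univ.filter fun z => ρ z = y ∧ G.Adj v₀ z).card
  have hw0 : 0 < w := Finset.card_pos.2 ⟨v₀, by simp [hx]⟩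
  have hcol : ∀ y, ∑ c, m c x y = w * t y := fun y => by rw [hm.total, hx, h.pairCount_eq]
  have hzero : ∀ c y, m c v₀ y = 0 := by
    intro c y
    have h1 := hm.row c v₀
    rw [Finset.card_eq_zero.2 (Finset.filter_eq_empty_iff.2 fun u _ => hunused u),
      Nat.le_zero, Finset.sum_eq_zero_iff] at h1
    exact h1 y (mem_univ y)
  -- The edges at `x` form a matrix of colours against other ends. It is split into `w` shares, one
  -- per vertex of the fibre, each using a colour at most once; since the column sums equal `w * t
  -- y`, every share has exactly `t y` edges to `y`.
  obtain ⟨f, hf, hfr, hfc⟩ := exists_capacity_decomposition w (fun c y => m c x y)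
    (fun _ => 1) t (fun c => by simpa using hm.row c x) (fun y => (hcol y).le)
  have hfc' : ∀ s y, ∑ c, f s c y = t y := by
    intro s y
    have h1 : ∑ s, ∑ c, f s c y = ∑ _s : Fin w, t y := by
      rw [Finset.sum_comm]
      simp [hf, hcol]
    exact (Finset.sum_eq_sum_iff_of_le fun s _ => hfc s y).1 h1 s (mem_univ s)
  -- One share, `g`, goes to `v₀`; the other `w - 1` stay at `x`, which gives `hrow`.
  let s₀ : Fin w := ⟨0, hw0⟩
  let g := f s₀
  have hgle : ∀ c y, g c y ≤ m c x y := fun c y => by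
    rw [← hf c y]
    exact Finset.single_le_sum (f := fun s => f s c y) (fun _ _ => Nat.zero_le _) (mem_univ s₀)
  have hg1 : ∀ c y, g c y ≤ 1 := fun c y =>
    (Finset.single_le_sum (f := fun y => f s₀ c y) (fun _ _ => Nat.zero_le _)
      (mem_univ y)).trans (hfr s₀ c)
  have hgv : ∀ c, g c v₀ = 0 := fun c => by
    have := hgle c v₀
    rw [hm.symm, hzero] at this
    omega
  have hrow : ∀ c, ∑ y, m c x y + 1 ≤ ∑ y, g c y + w := by
    intro c
    have h1 : ∑ y, m c x y = ∑ s, ∑ y, f s c y := by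
      rw [Finset.sum_comm]
      simp [hf]
    rw [h1, ← Finset.add_sum_erase _ _ (mem_univ s₀)]
    have h2 : ∑ s ∈ univ.erase s₀, ∑ y, f s c y ≤ ∑ _s ∈ univ.erase s₀, 1 :=
      Finset.sum_le_sum fun s _ => hfr s c
    rw [Finset.sum_const, Finset.card_erase_of_mem (mem_univ _), Finset.card_univ,
      Fintype.card_fin] at h2
    simp only [smul_eq_mul, mul_one] at h2
    change ∑ y, g c y + _ + 1 ≤ _
    omega
  -- `p` removes the edges of `g` from `x` and `q` attaches them to `v₀`, both symmetrically. A loop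
  -- at `x` loses 2 from its double count and becomes an edge from `v₀` to `x`.
  let p : Fin k → V → V → ℕ := fun c a b =>
    (if a = x then g c b else 0) + if b = x then g c a else 0
  let q : Fin k → V → V → ℕ := fun c a b =>
    (if a = v₀ then g c b else 0) + if b = v₀ then g c a else 0
  have hle : ∀ c a b, p c a b ≤ m c a b := by
    intro c a b
    by_cases ha : a = x
    · by_cases hb : b = x
      · subst ha; subst hb
        simp only [p, if_true]
        -- Evenness matters here: if `g c x = 1`, then `m c x x` is positive and even, so 2 can be
        -- subtracted.
        have h1 := hgle c x
        have h2 := hg1 c x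
        obtain ⟨l, hl⟩ := hm.even c x
        omega
      · simp only [p, ha, hb, if_true, if_false]
        exact hgle c b
    · by_cases hb : b = x
      · simp only [p, ha, hb, if_true, if_false]
        rw [hm.symm, zero_add]
        exact hgle c a
      · simp [p, ha, hb]
  refine ⟨fun c a b => m c a b - p c a b + q c a b, ?_, ?_, ?_, ?_⟩
  · intro c a b
    simp only [p, q, hm.symm c a b]
    omega
  · intro c a
    obtain ⟨l, hl⟩ := hm.even c a
    refine ⟨l - (if a = x then g c a else 0) + (if a = v₀ then g c a else 0), ?_⟩
    have := hle c a a
    simp only [p, q] at this ⊢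
    omega
  · intro a b
    have h1 := pairCount_update (G := G) ρ v₀ a b
    have h2 : ∑ c, (m c a b - p c a b + q c a b) + ∑ c, p c a b
        = ∑ c, m c a b + ∑ c, q c a b := by
      rw [← Finset.sum_add_distrib, ← Finset.sum_add_distrib]
      refine Finset.sum_congr rfl fun c _ => ?_
      have := hle c a b
      omega
    have h3 : ∀ z a b : V, ∑ c, ((if a = z then g c b else 0) + if b = z then g c a else 0)
        = (if a = z then t b else 0) + if b = z then t a else 0 := by
      intro z a b
      rw [Finset.sum_add_distrib]
      split_ifs <;> simp [g, hfc']
    rw [hm.total] at h2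
    simp only [p, q] at h2 ⊢
    rw [h3, h3] at h2
    simp only [t] at h2
    rw [← hx] at h1
    omega
  · intro c a
    have h2 : ∑ b, (m c a b - p c a b + q c a b) + ∑ b, p c a b
        = ∑ b, m c a b + ∑ b, q c a b := by
      rw [← Finset.sum_add_distrib, ← Finset.sum_add_distrib]
      refine Finset.sum_congr rfl fun b _ => ?_
      have := hle c a b
      omega
    have h3 : ∀ z : V, ∑ b, ((if a = z then g c b else 0) + if b = z then g c a else 0)
        = (if a = z then ∑ b, g c b else 0) + g c a := by
      intro z
      rw [Finset.sum_add_distrib]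
      split_ifs <;> simp
    have hp : ∑ b, p c a b = (if a = x then ∑ b, g c b else 0) + g c a := h3 x
    have hq : ∑ b, q c a b = (if a = v₀ then ∑ b, g c b else 0) + g c a := h3 v₀
    rw [hp, hq] at h2
    by_cases ha : a = v₀
    · have hax : a ≠ x := fun h' => hv₀ (by rw [← ha, h'])
      have h4 : ∑ b, m c a b = 0 := by simp [ha, hzero]
      have h5 := hfr s₀ c
      have h6 : 0 < (univ.filter fun v => Function.update ρ v₀ v₀ v = a).card :=
        Finset.card_pos.2 ⟨v₀, by simp [ha]⟩
      change ∑ b, g c b ≤ 1 at h5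
      rw [if_neg hax, if_pos ha] at h2
      omega
    · by_cases hax : a = x
      · have h4 : (univ.filter fun v => Function.update ρ v₀ v₀ v = a)
            = (univ.filter fun v => ρ v = x).erase v₀ := by
          ext v
          by_cases hv : v = v₀
          · subst hv
            simpa using fun h' => ha h'.symm
          · simp [hv, hax]
        rw [h4, Finset.card_erase_of_mem (by simp [hx])]
        have h5 := hrow c
        rw [if_pos hax, if_neg ha] at h2
        rw [← hax] at h5
        omega
      · have h4 : (univ.filter fun v => Function.update ρ v₀ v₀ v = a)
            = univ.filter fun v => ρ v = a := by
          ext v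
          by_cases hv : v = v₀
          · subst hv
            simp only [mem_filter, mem_univ, true_and, Function.update_self]
            exact ⟨fun h' => absurd h'.symm ha, fun h' => absurd h'.symm hax⟩
          · simp [hv]
        rw [h4]
        have h5 := hm.row c a
        rw [if_neg hax, if_neg ha] at h2
        omega

/-- Every edge-colouring of an amalgamation along twin fibres comes from an edge-colouring. -/
theorem IsAmalgamColouring.exists_id {k : ℕ} (N : ℕ) : ∀ (ρ : V → V) (m : Fin k → V → V → ℕ),
    (univ.filter fun v => ρ v ≠ v).card = N → G.IsAmalgamColouring ρ m → G.HasTwinFibres ρ →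
      (∀ v, ρ (ρ v) = ρ v) → ∃ m' : Fin k → V → V → ℕ, G.IsAmalgamColouring id m' := by
  induction N with
  | zero =>
    intro ρ m hN hm _ _
    rw [Finset.card_eq_zero, Finset.filter_eq_empty_iff] at hN
    have : ρ = id := funext fun v => not_not.1 (hN (mem_univ v))
    exact ⟨m, this ▸ hm⟩
  | succ N ih =>
    intro ρ m hN hm h hρ
    obtain ⟨v₀, hv₀⟩ := Finset.card_pos.1
      (by rw [hN]; exact Nat.succ_pos N : 0 < (univ.filter fun v => ρ v ≠ v).card)
    have hv : ρ v₀ ≠ v₀ := by simpa using hv₀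
    obtain ⟨m', hm'⟩ := hm.exists_update h hρ hv
    refine ih (Function.update ρ v₀ v₀) m' ?_ hm' (h.update hρ hv) fun v => ?_
    · have : (univ.filter fun v => Function.update ρ v₀ v₀ v ≠ v)
          = (univ.filter fun v => ρ v ≠ v).erase v₀ := by
        ext v
        by_cases hvv : v = v₀
        · subst hvv; simp
        · simp [hvv]
      rw [this, Finset.card_erase_of_mem hv₀, hN]
      rfl
    · by_cases hvv : v = v₀
      · subst hvv; simp
      · rw [Function.update_of_ne hvv, Function.update_of_ne, hρ]
        exact fun h' => hv (h' ▸ hρ v)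

/-- Over `id` all fibres are singletons, so each colour has degree at most 1 at each vertex. Any
colour with positive multiplicity on an edge may be assigned to it. -/
theorem IsAmalgamColouring.exists_isProperEdgeColouring {k : ℕ} {m : Fin k → V → V → ℕ}
    (hm : G.IsAmalgamColouring id m) : ∃ c : G.edgeSet → Fin k, IsProperEdgeColouring c := by
  have hex : ∀ e : G.edgeSet, ∃ c : Fin k, ∀ u v, (e : Sym2 V) = s(u, v) → 0 < m c u v := by
    rintro ⟨e, he⟩
    induction e using Sym2.ind with
    | _ a b =>
    have hab : G.Adj a b := he
    have h1 : 0 < ∑ c, m c a b := by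
      rw [hm.total, pairCount_eq_sum]
      refine Finset.sum_pos' (fun _ _ => Nat.zero_le _) ⟨a, by simp, Finset.card_pos.2 ⟨b, ?_⟩⟩
      simpa using hab
    obtain ⟨c, -, hc⟩ := Finset.exists_lt_of_sum_lt (s := univ) (f := fun _ : Fin k => 0)
      (g := fun c => m c a b) (by simpa using h1)
    refine ⟨c, fun u v huv => ?_⟩
    rcases Sym2.eq_iff.1 huv with ⟨rfl, rfl⟩ | ⟨rfl, rfl⟩
    · exact hc
    · rwa [hm.symm]
  choose c hc using hex
  refine ⟨c, ?_⟩
  rintro e f hef ⟨v, hve, hvf⟩ hcol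
  obtain ⟨a, ha⟩ := hve
  obtain ⟨b, hb⟩ := hvf
  have hab : a ≠ b := by
    rintro rfl
    exact hef (Subtype.ext (ha.trans hb.symm))
  have h1 := hc e v a ha
  have h2 := hc f v b hb
  rw [← hcol] at h2
  have h3 := hm.row (c e) v
  have h4 : m (c e) v a + m (c e) v b ≤ ∑ y, m (c e) v y := by
    rw [← Finset.sum_pair hab]
    exact Finset.sum_le_sum_of_subset (Finset.subset_univ _)
  have h5 : (univ.filter fun u => id u = v).card = 1 := by simp [Finset.filter_eq']
  omega

end SimpleGraph

/-! ### Orientations with prescribed out-degrees -/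

theorem exists_half_sum {N : Type*} [Fintype N] (T : N → N → ℕ) (hs : ∀ x y, T x y = T y x)
    (h0 : ∀ x, T x x = 0) : ∃ H : N → N → ℕ, (∀ x y, H x y + H y x = T x y) ∧
      ∀ U : Finset N, ∑ x ∈ U, ∑ y ∈ U, T x y = 2 * ∑ x ∈ U, ∑ y ∈ U, H x y := by
  classical
  -- An arbitrary linear order selects one of the two ordered copies of each edge.
  let e := Fintype.equivFin N
  have hH : ∀ x y, ((if e x < e y then T x y else 0) + if e y < e x then T y x else 0)
      = T x y := by
    intro x y
    rcases lt_trichotomy (e x) (e y) with h | h | h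
    · simp [h, h.not_gt]
    · rw [e.injective h, h0]; simp
    · simp [h, h.not_gt, hs x y]
  refine ⟨fun x y => if e x < e y then T x y else 0, hH, fun U => ?_⟩
  have h1 : ∑ x ∈ U, ∑ y ∈ U, T x y = (∑ x ∈ U, ∑ y ∈ U, if e x < e y then T x y else 0)
      + ∑ x ∈ U, ∑ y ∈ U, if e y < e x then T y x else 0 := by
    rw [← Finset.sum_add_distrib]
    refine Finset.sum_congr rfl fun x _ => ?_
    rw [← Finset.sum_add_distrib]
    exact Finset.sum_congr rfl fun y _ => (hH x y).symm
  rw [h1, two_mul]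
  congr 1
  rw [Finset.sum_comm]

/-- A loopless multigraph has an orientation with prescribed out-degrees if every set of vertices
spans at most as many edges as the sum of the out-degrees. -/
theorem exists_orientation {N : Type*} [Fintype N] [DecidableEq N] (T : N → N → ℕ)
    (hs : ∀ x y, T x y = T y x) (h0 : ∀ x, T x x = 0) (out : N → ℕ)
    (htot : 2 * ∑ x, out x = ∑ x, ∑ y, T x y)
    (hU : ∀ U : Finset N, ∑ x ∈ U, ∑ y ∈ U, T x y ≤ 2 * ∑ x ∈ U, out x) :
    ∃ z : N → N → ℕ, (∀ x y, z x y + z y x = T x y) ∧ ∀ x, ∑ y, z x y = out x := by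
  obtain ⟨H, hH, hHU⟩ := exists_half_sum T hs h0
  have hH0 : ∀ x, H x x = 0 := fun x => by have := hH x x; rw [h0] at this; omega
  -- Hall's theorem matches each edge to an out-slot at one of its ends, which becomes its tail.
  -- Edges and slots are equinumerous, so all slots are filled.
  let E := Σ p : N × N, Fin (H p.1 p.2)
  let S := Σ x : N, Fin (out x)
  let t : E → Finset S := fun e => univ.filter fun s => s.1 = e.1.1 ∨ s.1 = e.1.2
  have hne : ∀ e : E, e.1.1 ≠ e.1.2 := by
    rintro ⟨⟨a, b⟩, i⟩ (h : a = b)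
    subst h
    exact absurd i.2 (by simp [hH0])
  have hall : ∀ A : Finset E, A.card ≤ (A.biUnion t).card := by
    intro A
    let U : Finset N := A.biUnion fun e => {e.1.1, e.1.2}
    have hmem : ∀ e ∈ A, e.1.1 ∈ U ∧ e.1.2 ∈ U := fun e he =>
      ⟨Finset.mem_biUnion.2 ⟨e, he, by simp⟩, Finset.mem_biUnion.2 ⟨e, he, by simp⟩⟩
    have h1 : A ⊆ (U ×ˢ U).sigma fun _ => univ := fun e he =>
      Finset.mem_sigma.2 ⟨Finset.mem_product.2 (hmem e he), mem_univ _⟩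
    have h2 : (U.sigma fun _ => univ) ⊆ A.biUnion t := by
      intro s hs'
      have hsU : s.1 ∈ U := by simpa using hs'
      obtain ⟨e, he, hse⟩ := Finset.mem_biUnion.1 hsU
      exact Finset.mem_biUnion.2 ⟨e, he, by simpa [t] using hse⟩
    have h3 := Finset.card_le_card h1
    have h4 := Finset.card_le_card h2
    rw [Finset.card_sigma] at h3 h4
    simp only [Finset.card_univ, Fintype.card_fin] at h3 h4
    rw [Finset.sum_product] at h3
    dsimp only at h3
    have h5 := hU U
    rw [hHU] at h5
    omega
  obtain ⟨f, hf, hft⟩ := (Finset.all_card_le_biUnion_card_iff_exists_injective t).1 hall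
  have hcard : Fintype.card E = Fintype.card S := by
    simp only [E, S, Fintype.card_sigma, Fintype.card_fin]
    rw [Fintype.sum_prod_type]
    dsimp only
    have := hHU univ
    omega
  have hbij : Function.Bijective f := (Fintype.bijective_iff_injective_and_card f).2 ⟨hf, hcard⟩
  have hft' : ∀ e, (f e).1 = e.1.1 ∨ (f e).1 = e.1.2 := fun e => by simpa [t] using hft e
  have hcardE : ∀ x y, (univ.filter fun e : E => e.1 = (x, y)).card = H x y := by
    intro x y
    have : (univ.filter fun e : E => e.1 = (x, y))
        = ({(x, y)} : Finset (N × N)).sigma fun _ => univ := by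
      ext e; rw [Finset.mem_sigma]; simp
    rw [this, Finset.card_sigma]
    simp
  refine ⟨fun x y => (univ.filter fun e : E =>
    (f e).1 = x ∧ (e.1 = (x, y) ∨ e.1 = (y, x))).card, fun x y => ?_, fun x => ?_⟩
  · by_cases hxy : x = y
    · subst hxy
      have : (univ.filter fun e : E => (f e).1 = x ∧ (e.1 = (x, x) ∨ e.1 = (x, x))) = ∅ := by
        refine Finset.filter_eq_empty_iff.2 fun e _ he => hne e ?_
        rcases he.2 with h | h <;> rw [h]
      simp only [this, h0, Finset.card_empty]
    · rw [← hH x y, ← hcardE x y, ← hcardE y x, ← Finset.card_union_of_disjoint,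
        ← Finset.card_union_of_disjoint]
      · congr 1
        ext e
        simp only [mem_union, mem_filter, mem_univ, true_and]
        constructor
        · tauto
        · intro h
          have h' := hft' e
          rcases h with h | h <;> rw [h] at h' <;> simp only at h' <;> tauto
      · rw [Finset.disjoint_left]
        intro e he he'
        simp only [mem_filter, mem_univ, true_and] at he he'
        rw [he] at he'
        exact hxy (Prod.ext_iff.1 he').1
      · rw [Finset.disjoint_left]
        intro e he he'
        simp only [mem_filter, mem_univ, true_and] at he he'
        exact hxy (he.1.symm.trans he'.1)
  · have h1 : (univ.filter fun e : E => (f e).1 = x).card = out x := by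
      have h2 : (univ.filter fun e : E => (f e).1 = x).card
          = (univ.filter fun s : S => s.1 = x).card := by
        refine Finset.card_bij (fun e _ => f e) (fun e he => by simpa using he)
          (fun a _ b _ hab => hf hab) fun s hs' => ?_
        obtain ⟨e, rfl⟩ := hbij.2 s
        exact ⟨e, by simpa using hs', rfl⟩
      have h3 : (univ.filter fun s : S => s.1 = x) = ({x} : Finset N).sigma fun _ => univ := by
        ext s; rw [Finset.mem_sigma]; simp
      rw [h2, h3, Finset.card_sigma]
      simp
    -- The edges with tail `x` are sorted by their other end.
    rw [← h1, Finset.card_eq_sum_card_fiberwise (t := univ)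
      (f := fun e : E => if e.1.1 = x then e.1.2 else e.1.1) (fun _ _ => by simp)]
    refine Finset.sum_congr rfl fun y _ => ?_
    rw [Finset.filter_filter]
    refine congrArg Finset.card ?_
    ext e
    obtain ⟨⟨a, b⟩, i⟩ := e
    have h' := hft' ⟨(a, b), i⟩
    have h'' := hne ⟨(a, b), i⟩
    simp only [mem_filter, mem_univ, true_and, Prod.mk.injEq] at h' h'' ⊢
    constructor
    · rintro ⟨h4, ⟨rfl, rfl⟩ | ⟨rfl, rfl⟩⟩
      · exact ⟨h4, by simp⟩
      · exact ⟨h4, by simp [h'']⟩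
    · rintro ⟨h4, h5⟩
      refine ⟨h4, ?_⟩
      by_cases hax : a = x
      · rw [if_pos hax] at h5
        exact Or.inl ⟨hax, h5⟩
      · rw [if_neg hax] at h5
        rw [h4] at h'
        rcases h' with h' | h'
        · exact absurd h'.symm hax
        · exact Or.inr ⟨h5, h'.symm⟩

/-! ### Balancing signs and deficiencies to obtain a capacity orientation -/

theorem exists_sign_sum_eq_card_mod_two {ι : Type*} [DecidableEq ι] (O : Finset ι) :
    ∃ σ : ι → ℤ, (∀ i ∈ O, σ i = 1 ∨ σ i = -1) ∧ (∀ i ∉ O, σ i = 0) ∧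
      ∑ i ∈ O, σ i = (O.card % 2 : ℕ) := by
  induction O using Finset.induction_on with
  | empty => exact ⟨0, by simp, by simp, by simp⟩
  | insert a O ha ih =>
    obtain ⟨σ, h1, h2, h3⟩ := ih
    refine ⟨Function.update σ a (if O.card % 2 = 0 then 1 else -1), fun i hi => ?_,
      fun i hi => ?_, ?_⟩
    · by_cases hia : i = a
      · subst hia
        rw [Function.update_self]
        split_ifs <;> simp
      · rw [Function.update_of_ne hia]
        exact h1 i ((Finset.mem_insert.1 hi).resolve_left hia)
    · rw [Finset.mem_insert, not_or] at hi
      rw [Function.update_of_ne hi.1]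
      exact h2 i hi.2
    · rw [Finset.sum_insert ha, Function.update_self, Finset.card_insert_of_notMem ha,
        Finset.sum_congr rfl fun i hi => Function.update_of_ne (ne_of_mem_of_not_mem hi ha) _ _, h3]
      split_ifs with h <;> omega

/-- Start with balanced signs on the odd `d i` and raise entries by 2: equal parity and `δ i < d i`
leave room for that. The bounds `-1` and `N + 1` are kept for the cut estimate in
`exists_capacity_orientation`. -/
theorem exists_sum_eq_of_parity {ι : Type*} [Fintype ι] (d : ι → ℕ) (N : ℕ) :
    N ≤ ∑ i, d i → N % 2 = (∑ i, d i) % 2 → ∃ δ : ι → ℤ, (∀ i, -1 ≤ δ i ∧ δ i ≤ d i ∧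
      δ i ≤ N + 1 ∧ δ i % 2 = d i % 2) ∧ ∑ i, δ i = N := by
  classical
  have hbase : ∀ N < 2, N % 2 = (∑ i, d i) % 2 → ∃ δ : ι → ℤ, (∀ i, -1 ≤ δ i ∧ δ i ≤ d i ∧
      δ i ≤ (N : ℤ) + 1 ∧ δ i % 2 = d i % 2) ∧ ∑ i, δ i = N := by
    intro N hN hpar
    obtain ⟨σ, h1, h2, h3⟩ :=
      exists_sign_sum_eq_card_mod_two (univ.filter fun i => d i % 2 = 1)
    refine ⟨σ, fun i => ?_, ?_⟩
    · by_cases hi : d i % 2 = 1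
      · have := h1 i (by simpa using hi)
        omega
      · have := h2 i (by simpa using hi)
        omega
    · have h4 : ∑ i, σ i = ∑ i ∈ univ.filter (fun i => d i % 2 = 1), σ i :=
        (Finset.sum_subset (Finset.subset_univ _) fun i _ hi => h2 i hi).symm
      have h5 : (∑ i, d i) % 2 = (univ.filter fun i => d i % 2 = 1).card % 2 := by
        rw [Finset.sum_nat_mod, Finset.card_filter]
        congr 1
        refine Finset.sum_congr rfl fun i _ => ?_
        split_ifs <;> omega
      rw [h4, h3]
      omega
  induction N using Nat.twoStepInduction with
  | zero => exact fun _ h => hbase 0 (by norm_num) h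
  | one => exact fun _ h => hbase 1 (by norm_num) h
  | more N ih _ =>
    intro hle hpar
    obtain ⟨δ, h1, h2⟩ := ih (by omega) (by omega)
    obtain ⟨i, -, hi⟩ : ∃ i ∈ univ, δ i < (d i : ℤ) := by
      refine Finset.exists_lt_of_sum_lt ?_
      rw [h2]
      exact_mod_cast (by omega : N < ∑ i, d i)
    refine ⟨Function.update δ i (δ i + 2), fun j => ?_, ?_⟩
    · by_cases hj : j = i
      · subst hj
        rw [Function.update_self]
        have := h1 j
        push_cast
        omega
      · rw [Function.update_of_ne hj]
        have := h1 j
        push_cast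
        omega
    · rw [Finset.sum_update_of_mem (mem_univ i), Finset.sdiff_singleton_eq_erase]
      have := Finset.add_sum_erase univ δ (mem_univ i)
      push_cast
      omega

/-- The edges between distinct amalgamated vertices of weights `w` can be oriented so that the
out- and in-degrees (each loop counting for both) are at most `k` times capacities which add up
to the weights. -/
theorem exists_capacity_orientation {V : Type*} [Fintype V] [DecidableEq V] (w : V → ℕ)
    (T : V → V → ℕ) (k : ℕ) (hT : ∀ x y, x ≠ y → T x y = w x * w y) (hTeven : ∀ x, Even (T x x))
    (hw : ∀ x, w x ≠ 1) (hdeg : ∀ x, ∑ y, T x y ≤ w x * k)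
    (hk : ∀ x y, x ≠ y → w x ≠ 0 → w y ≠ 0 → k + 1 ≤ ∑ v, w v)
    (hodd : (∑ v, w v) % 2 = 1 → k + ∑ x, ∑ y, T x y ≤ (∑ v, w v) * k) :
    ∃ (z : V → V → ℕ) (r s : V → ℕ), (∀ x y, z x y + z y x = T x y) ∧ (∀ x, r x + s x = w x) ∧
      (∀ x, ∑ y, z x y ≤ k * r x) ∧ ∀ x, ∑ y, z y x ≤ k * s x := by
  set n := ∑ v, w v with hn
  choose l hl using hTeven
  let T₀ : V → V → ℕ := fun x y => if x = y then 0 else w x * w y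
  have hT₀s : ∀ x y, T₀ x y = T₀ y x := fun x y => by
    simp only [T₀, eq_comm (a := x), mul_comm (w x)]
  have hT₀0 : ∀ x, T₀ x x = 0 := fun x => by simp [T₀]
  have hTT₀ : ∀ x, ∑ y, T x y = ∑ y, T₀ x y + (l x + l x) := by
    intro x
    rw [← hl, ← Finset.add_sum_erase _ _ (mem_univ x), ← Finset.add_sum_erase _ (T₀ x) (mem_univ x),
      hT₀0, zero_add, add_comm]
    congr 1
    refine Finset.sum_congr rfl fun y hy => ?_
    have hxy := (Finset.ne_of_mem_erase hy).symm
    simp [T₀, hxy, hT x y hxy]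
  have hT₀U : ∀ (U : Finset V), ∀ x ∈ U,
      (∑ y ∈ U, (T₀ x y : ℤ)) = w x * ∑ y ∈ U, (w y : ℤ) - w x * w x := by
    intro U x hx
    rw [← Finset.add_sum_erase _ _ hx, ← Finset.add_sum_erase _ (fun y => (w y : ℤ)) hx, hT₀0,
      mul_add, Finset.mul_sum]
    have : ∑ y ∈ U.erase x, (T₀ x y : ℤ) = ∑ y ∈ U.erase x, (w x : ℤ) * w y := by
      refine Finset.sum_congr rfl fun y hy => ?_
      simp [T₀, (Finset.ne_of_mem_erase hy).symm]
    rw [this]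
    push_cast
    ring
  let d : V → ℕ := fun x => w x * k - ∑ y, T x y
  have hd : ∀ x, d x + ∑ y, T x y = w x * k := fun x => Nat.sub_add_cancel (hdeg x)
  have hdsum : ∑ x, d x + ∑ x, ∑ y, T x y = n * k := by
    rw [← Finset.sum_add_distrib, Finset.sum_congr rfl fun x _ => hd x, ← Finset.sum_mul]
  have hTsum : (∑ x, ∑ y, T x y) % 2 = 0 := by
    obtain ⟨H, -, hH⟩ := exists_half_sum T₀ hT₀s hT₀0
    simp_rw [hTT₀]
    rw [Finset.sum_add_distrib, hH univ, Finset.sum_add_distrib]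
    omega
  -- `σ x` will be `s x - r x`: zero for even weights and a sign for odd ones, with total `n % 2`.
  obtain ⟨σ, hσ1, hσ0, hσs⟩ :=
    exists_sign_sum_eq_card_mod_two (univ.filter fun x => w x % 2 = 1)
  have hσ : ∀ x, (w x % 2 = 1 ∧ (σ x = 1 ∨ σ x = -1)) ∨ (w x % 2 = 0 ∧ σ x = 0) := by
    intro x
    rcases Nat.mod_two_eq_zero_or_one (w x) with h | h
    · exact Or.inr ⟨h, hσ0 x (by simp [h])⟩
    · exact Or.inl ⟨h, hσ1 x (by simp [h])⟩
  have hσsum : ∑ x, σ x = ((n % 2 : ℕ) : ℤ) := by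
    have h4 : ∑ x, σ x = ∑ x ∈ univ.filter (fun x => w x % 2 = 1), σ x :=
      (Finset.sum_subset (Finset.subset_univ _) fun x _ hx => hσ0 x hx).symm
    have h5 : n % 2 = (univ.filter fun x => w x % 2 = 1).card % 2 := by
      rw [hn, Finset.sum_nat_mod, Finset.card_filter]
      congr 1
      refine Finset.sum_congr rfl fun x _ => ?_
      split_ifs <;> omega
    rw [h4, hσs, h5]
  -- For odd `n` the total must be `k`, to offset the total of `σ`. It is attainable because `hodd`
  -- says that the deficiencies `d` add up to at least `k`.
  obtain ⟨δ, hδ, hδs⟩ := exists_sum_eq_of_parity d (n % 2 * k)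
    (by
      rcases Nat.mod_two_eq_zero_or_one n with h | h
      · simp [h]
      · have := hodd h
        rw [h, one_mul]
        omega)
    (by
      have h1 : (n % 2 * k) % 2 = (n * k) % 2 := by simp [Nat.mul_mod]
      omega)
  -- `D x` is the intended out-degree minus in-degree, loops ignored. Both capacity bounds then
  -- amount to `|δ x| ≤ d x`.
  let D : V → ℤ := fun x => -σ x * k + δ x
  have hDs : ∑ x, D x = 0 := by
    simp only [D]
    rw [Finset.sum_add_distrib, hδs, ← Finset.sum_mul, Finset.sum_neg_distrib, hσsum]
    push_cast
    ring
  have hD0 : ∀ x, w x = 0 → D x = 0 := by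
    intro x hx
    have h1 := hd x
    have h2 := hδ x
    have h3 := hσ x
    rw [hx, zero_mul] at h1
    have h4 : d x = 0 := by omega
    have h5 : σ x = 0 := by omega
    rw [h4] at h2
    simp only [D, h5]
    push_cast at h2
    omega
  -- Dividing by the weights, this says `D y / w y - D x / w x ≤ n`. The bounds `hlow` and `hupp`
  -- give at most `(3 * k + 2) / 3`, which is below `k + 1 ≤ n`. They use that odd weights are at
  -- least 3 and even ones at least 2.
  have hpair : ∀ x y, 0 ≤ w y * D x - w x * D y + n * (w x * w y) := by
    intro x y
    by_cases hx : w x = 0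
    · simp [hx, hD0 x hx]
    by_cases hy : w y = 0
    · simp [hy, hD0 y hy]
    by_cases hxy : x = y
    · subst hxy
      have : (0 : ℤ) ≤ n * (w x * w x) := by positivity
      linarith
    have hkn := hk x y hxy hx hy
    have hk1 : 1 ≤ k := by
      by_contra h
      have h1 := hdeg x
      rw [show k = 0 by omega, mul_zero, Nat.le_zero, Finset.sum_eq_zero_iff] at h1
      have h2 := h1 y (mem_univ y)
      rw [hT x y hxy] at h2
      exact (Nat.mul_ne_zero hx hy) h2
    have hNk : n % 2 * k ≤ k := by
      rcases Nat.mod_two_eq_zero_or_one n with h | h <;> simp [h]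
    have hNk' : ((n % 2 * k : ℕ) : ℤ) ≤ k := by exact_mod_cast hNk
    have hlow : ∀ x, w x ≠ 0 → -((k + 1 : ℤ) * w x) ≤ 3 * D x := by
      intro x hx
      have h1 := hw x
      have h2 := hδ x
      have hk1' : (1 : ℤ) ≤ k := by exact_mod_cast hk1
      rcases hσ x with ⟨h3, h4⟩ | ⟨h3, h4⟩
      · have h5 : (3 : ℤ) ≤ w x := by omega
        have h6 : -(k : ℤ) - 1 ≤ D x := by
          rcases h4 with h4 | h4 <;> simp only [D, h4] <;> linarith [h2.1]
        nlinarith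
      · have h5 : (2 : ℤ) ≤ w x := by omega
        have h6 : -1 ≤ D x := by simp only [D, h4]; linarith [h2.1]
        nlinarith
    have hupp : ∀ x, w x ≠ 0 → 3 * D x ≤ (2 * k + 1 : ℤ) * w x := by
      intro x hx
      have h1 := hw x
      have h2 := hδ x
      have hk1' : (1 : ℤ) ≤ k := by exact_mod_cast hk1
      rcases hσ x with ⟨h3, h4⟩ | ⟨h3, h4⟩
      · have h5 : (3 : ℤ) ≤ w x := by omega
        have h6 : D x ≤ 2 * k + 1 := by
          rcases h4 with h4 | h4 <;> simp only [D, h4] <;> linarith [h2.2.2.1]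
        nlinarith
      · have h5 : (2 : ℤ) ≤ w x := by omega
        have h6 : D x ≤ k + 1 := by simp only [D, h4]; linarith [h2.2.2.1]
        nlinarith
    have h1 := mul_le_mul_of_nonneg_left (hlow x hx) (Int.natCast_nonneg (w y))
    have h2 := mul_le_mul_of_nonneg_left (hupp y hy) (Int.natCast_nonneg (w x))
    have h3 : (k + 1 : ℤ) ≤ n := by exact_mod_cast hkn
    have h4 := mul_le_mul_of_nonneg_right h3 (by positivity : (0 : ℤ) ≤ w x * w y)
    have h5 : (0 : ℤ) ≤ w x * w y := by positivity
    nlinarith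
  -- This is Hall's condition for the orientation. Summing `hpair` over `U` times its complement
  -- gives `n` times the claim, since `D` has total zero.
  have hcut : ∀ U : Finset V, 0 ≤ (∑ x ∈ U, (w x : ℤ)) * (n - ∑ x ∈ U, (w x : ℤ))
      + ∑ x ∈ U, D x := by
    intro U
    have hwc : ∑ x ∈ Uᶜ, (w x : ℤ) = n - ∑ x ∈ U, (w x : ℤ) := by
      rw [hn, Nat.cast_sum, ← Finset.sum_add_sum_compl U]; ring
    have hDc : ∑ x ∈ Uᶜ, D x = - ∑ x ∈ U, D x := by
      have := Finset.sum_add_sum_compl U D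
      linarith
    have h1 : 0 ≤ ∑ x ∈ U, ∑ y ∈ Uᶜ, ((w y : ℤ) * D x - w x * D y + n * (w x * w y)) :=
      Finset.sum_nonneg fun x _ => Finset.sum_nonneg fun y _ => hpair x y
    simp_rw [Finset.sum_add_distrib, Finset.sum_sub_distrib, ← Finset.sum_mul, ← Finset.mul_sum,
      ← Finset.sum_mul, hwc, hDc] at h1
    rcases Nat.eq_zero_or_pos n with h0 | h0
    · have hw0 : ∀ x, w x = 0 := fun x => by
        rw [hn, Finset.sum_eq_zero_iff] at h0
        exact h0 x (mem_univ x)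
      simp [hw0, fun x => hD0 x (hw0 x)]
    · have hn0 : (0 : ℤ) < n := by exact_mod_cast h0
      exact (mul_nonneg_iff_of_pos_left hn0).1 (by linarith)
  have hR : ∀ x, (∑ y, (T₀ x y : ℤ)) = w x * (n - w x) := by
    intro x
    rw [hT₀U univ x (mem_univ x), hn]
    push_cast
    ring
  have hdz : ∀ x, (d x : ℤ) + w x * (n - w x) + 2 * l x = w x * k := by
    intro x
    rw [← hR x]
    have := hd x
    rw [hTT₀] at this
    zify at this
    linarith
  -- Integrality holds because `w x - σ x` and `d x - δ x` are even; nonnegativity is the cut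
  -- condition for a singleton.
  have hout : ∀ x, ∃ o : ℕ, (2 * o : ℤ) = w x * (n - w x) + D x := by
    intro x
    have h1 := hcut {x}
    simp only [Finset.sum_singleton] at h1
    have h2 := hdz x
    have h3 : ((w x : ℤ) * k - σ x * k) % 2 = 0 := by
      rw [← sub_mul, Int.mul_emod]
      have : ((w x : ℤ) - σ x) % 2 = 0 := by have := hσ x; omega
      rw [this]; simp
    have h4 := (hδ x).2.2.2
    have h5 : D x = -(σ x * k) + δ x := by simp only [D]; ring
    refine ⟨((w x * (n - w x) + D x) / 2).toNat, ?_⟩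
    omega
  choose out hout using hout
  obtain ⟨z, hz, hzo⟩ := exists_orientation T₀ hT₀s hT₀0 out
    (by
      zify
      rw [Finset.mul_sum]
      simp_rw [hout, hR]
      rw [Finset.sum_add_distrib, hDs, add_zero])
    (by
      intro U
      zify
      rw [Finset.mul_sum]
      simp_rw [hout]
      rw [Finset.sum_congr rfl fun x hx => hT₀U U x hx, Finset.sum_add_distrib]
      have h1 := hcut U
      have h2 : ∑ x ∈ U, (w x : ℤ) * (n - w x) -
          ∑ x ∈ U, ((w x : ℤ) * ∑ y ∈ U, (w y : ℤ) - w x * w x)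
          = (∑ x ∈ U, (w x : ℤ)) * (n - ∑ x ∈ U, (w x : ℤ)) := by
        rw [← Finset.sum_sub_distrib, Finset.sum_mul]
        exact Finset.sum_congr rfl fun x _ => by ring
      linarith)
  have hrs : ∀ x, ∃ r s : ℕ, r + s = w x ∧ (r : ℤ) - s = -σ x := by
    intro x
    rcases hσ x with ⟨h1, h2 | h2⟩ | ⟨h1, h2⟩
    · exact ⟨w x / 2, w x / 2 + 1, by omega, by omega⟩
    · exact ⟨w x / 2 + 1, w x / 2, by omega, by omega⟩
    · exact ⟨w x / 2, w x / 2, by omega, by omega⟩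
  choose r s hrs hrs' using hrs
  have hloop : ∀ x, ∑ y, (if x = y then l x else 0) = l x := fun x => by simp
  have hzin : ∀ x, ∑ y, z y x + out x = ∑ y, T₀ x y := by
    intro x
    rw [← hzo x, ← Finset.sum_add_distrib]
    exact Finset.sum_congr rfl fun y _ => by rw [add_comm, hz]
  have hδd : ∀ x, -(d x : ℤ) ≤ δ x ∧ δ x ≤ d x := fun x => by
    have := hδ x
    omega
  refine ⟨fun x y => z x y + if x = y then l x else 0, r, s, fun x y => ?_, hrs, fun x => ?_,
    fun x => ?_⟩
  · by_cases hxy : x = y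
    · subst hxy
      have := hz x x
      rw [hT₀0] at this
      simp only [if_true]
      rw [hl]
      omega
    · have := hz x y
      simp only [hxy, Ne.symm hxy, if_false, T₀] at this ⊢
      rw [hT x y hxy]
      omega
  · rw [Finset.sum_add_distrib, hloop, hzo]
    have h1 := hdz x
    have h2 := hout x
    have h3 := hrs x
    have h4 := hrs' x
    have h5 : (2 * r x : ℤ) = w x - σ x := by omega
    have h6 : (2 * (k * r x) : ℤ) = w x * k - σ x * k := by
      rw [mul_left_comm, h5]; ring
    have h7 := (hδd x).2
    have h8 : D x = -(σ x * k) + δ x := by simp only [D]; ring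
    zify
    linarith
  · have hloop' : ∑ y, (if y = x then l y else 0) = l x := by simp
    rw [Finset.sum_add_distrib, hloop']
    have h1 := hdz x
    have h2 := hout x
    have h3 := hrs x
    have h4 := hrs' x
    have h5 : (2 * s x : ℤ) = w x + σ x := by omega
    have h6 : (2 * (k * s x) : ℤ) = w x * k + σ x * k := by
      rw [mul_left_comm, h5]; ring
    have h7 := (hδd x).1
    have h8 : D x = -(σ x * k) + δ x := by simp only [D]; ring
    have h9 := hzin x
    zify at h9 ⊢
    rw [hR] at h9
    linarith

/-! ### From orientations to edge-colourings of blow-ups -/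

namespace SimpleGraph

variable {V : Type*} [Fintype V] [DecidableEq V] {G : SimpleGraph V} [DecidableRel G.Adj]

theorem even_pairCount_self (ρ : V → V) (x : V) : Even (G.pairCount ρ x x) := by
  obtain ⟨H, -, hH⟩ := exists_half_sum (fun u v => if ρ u = x ∧ ρ v = x ∧ G.Adj u v then 1 else 0)
    (fun u v => by
      simp only [G.adj_comm u v]
      congr 1
      simp only [eq_iff_iff]
      tauto)
    (fun u => by simp)
  rw [pairCount, hH univ]
  exact even_two_mul _

theorem pairCount_of_ne {ρ : V → V} (h : ∀ u v, ρ u ≠ ρ v → G.Adj u v) {x y : V} (hxy : x ≠ y) :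
    G.pairCount ρ x y =
      (univ.filter fun v => ρ v = x).card * (univ.filter fun v => ρ v = y).card := by
  rw [pairCount_eq_sum, ← smul_eq_mul, ← Finset.sum_const]
  refine Finset.sum_congr rfl fun u hu => ?_
  congr 1
  ext v
  simp only [mem_filter, mem_univ, true_and] at hu ⊢
  exact ⟨fun hv => hv.1, fun hv => ⟨hv, h u v (by rw [hu, hv]; exact hxy)⟩⟩

theorem sum_pairCount (ρ : V → V) (x : V) :
    ∑ y, G.pairCount ρ x y = ∑ v ∈ univ.filter (fun v => ρ v = x), G.degree v := by
  simp_rw [pairCount_eq_sum]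
  rw [Finset.sum_comm]
  refine Finset.sum_congr rfl fun v _ => ?_
  rw [← card_neighborFinset_eq_degree,
    Finset.card_eq_sum_card_fiberwise (f := ρ) (t := univ) fun _ _ => by simp]
  refine Finset.sum_congr rfl fun y _ => ?_
  congr 1
  ext u
  simp [and_comm]

/-- A graph which is a blow-up of a complete graph with independent sets and cliques of at least
two vertices has a proper `k`-edge-colouring unless this is ruled out by the maximum degree or
by overfullness. -/
theorem exists_isProperEdgeColouring_of_twinFibres {ρ : V → V} {k : ℕ}
    (hρ : ∀ v, ρ (ρ v) = ρ v) (htwin : G.HasTwinFibres ρ) (hcross : ∀ u v, ρ u ≠ ρ v → G.Adj u v)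
    (hfib : ∀ v, ∃ u, u ≠ v ∧ ρ u = ρ v) (hdeg : ∀ v, G.degree v ≤ k)
    (hk : ∀ u v, ρ u ≠ ρ v → k + 1 ≤ Fintype.card V)
    (hodd : Fintype.card V % 2 = 1 → k + 2 * G.edgeFinset.card ≤ Fintype.card V * k) :
    ∃ c : G.edgeSet → Fin k, IsProperEdgeColouring c := by
  have hcard : ∑ x, (univ.filter fun v => ρ v = x).card = Fintype.card V := by
    rw [← Finset.card_univ, Finset.card_eq_sum_card_fiberwise (f := ρ) (t := univ)
      fun _ _ => by simp]
  have hsum : ∑ x, ∑ y, G.pairCount ρ x y = 2 * G.edgeFinset.card := by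
    simp_rw [sum_pairCount]
    rw [← G.sum_degrees_eq_twice_card_edges]
    exact Finset.sum_fiberwise _ _ _
  obtain ⟨z, r, s, hz, hrs, hzr, hzs⟩ := exists_capacity_orientation
    (fun x => (univ.filter fun v => ρ v = x).card) (G.pairCount ρ) k
    (fun x y hxy => pairCount_of_ne hcross hxy) (even_pairCount_self ρ)
    (fun x hx => by
      obtain ⟨v, hv⟩ := Finset.card_eq_one.1 hx
      have hvx : ρ v = x := by simpa using (hv ▸ mem_singleton_self v : v ∈ univ.filter _)
      obtain ⟨u, huv, hu⟩ := hfib v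
      have : u ∈ univ.filter fun v => ρ v = x := by simp [hu, hvx]
      rw [hv] at this
      exact huv (by simpa using this))
    (fun x => by
      rw [sum_pairCount, ← smul_eq_mul, ← Finset.sum_const]
      exact Finset.sum_le_sum fun v _ => hdeg v)
    (fun x y hxy hx hy => by
      obtain ⟨u, hu⟩ := Finset.card_pos.1 (Nat.pos_of_ne_zero hx)
      obtain ⟨v, hv⟩ := Finset.card_pos.1 (Nat.pos_of_ne_zero hy)
      simp only [mem_filter, mem_univ, true_and] at hu hv
      rw [hcard]
      exact hk u v (by rw [hu, hv]; exact hxy))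
    (by rw [hcard, hsum]; exact hodd)
  obtain ⟨f, hf, hfr, hfs⟩ := exists_capacity_decomposition k z r s hzr hzs
  -- Forgetting directions adds the capacities to `r x + s x`, the fibre size, and makes the loop
  -- counts even.
  have hm : G.IsAmalgamColouring ρ fun c x y => f c x y + f c y x :=
    { symm := fun c x y => add_comm _ _
      even := fun c x => ⟨_, rfl⟩
      total := fun x y => by rw [Finset.sum_add_distrib, hf, hf, hz]
      row := fun c x => by
        rw [Finset.sum_add_distrib, ← hrs x]
        exact add_le_add (hfr c x) (hfs c x) }
  obtain ⟨m', hm'⟩ := hm.exists_id _ ρ _ rfl htwin hρ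
  exact hm'.exists_isProperEdgeColouring

end SimpleGraph

/-! ### Rainbow paths, lower bounds and the cases by universal vertices -/

namespace SimpleGraph

theorem IsProperEdgeColouring.exists_of_injective {V W K : Type*} {G : SimpleGraph V}
    {H : SimpleGraph W} {c : H.edgeSet → K} (hc : IsProperEdgeColouring c) {f : V → W}
    (hf : Function.Injective f) (hadj : ∀ u v, G.Adj u v → H.Adj (f u) (f v)) :
    ∃ c : G.edgeSet → K, IsProperEdgeColouring c := by
  let φ : G →g H := ⟨f, fun {u v} h => hadj u v h⟩
  refine ⟨fun e => c (φ.mapEdgeSet e), fun e e' hne hv => hc _ _ ?_ ?_⟩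
  · exact fun h => hne (Hom.mapEdgeSet.injective φ hf h)
  · obtain ⟨v, h1, h2⟩ := hv
    exact ⟨f v, Sym2.mem_map.2 ⟨v, h1, rfl⟩, Sym2.mem_map.2 ⟨v, h2, rfl⟩⟩

theorem IsProperEdgeColouring.exists_isRainbowPath_of_adj_adj {V K : Type*} {G : SimpleGraph V}
    {c : G.edgeSet → K} (hc : IsProperEdgeColouring c) {u v w : V} (huv : u ≠ v)
    (huw : G.Adj u w) (hwv : G.Adj w v) : ∃ p : G.Walk u v, IsRainbowPath c p := by
  have hne : s(u, w) ≠ s(w, v) := by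
    intro h
    rcases Sym2.eq_iff.1 h with ⟨h1, -⟩ | ⟨h1, -⟩
    · exact huw.ne h1
    · exact huv h1
  have key := hc ⟨s(u, w), huw⟩ ⟨s(w, v), hwv⟩ (fun h => hne (Subtype.ext_iff.1 h))
    ⟨w, by simp, by simp⟩
  refine ⟨.cons huw (.cons hwv .nil), ?_, ?_⟩
  · simp [huv, huw.ne, hwv.ne]
  · rintro ⟨e, he⟩ ⟨e', he'⟩ h1 h2 h3
    simp only [Walk.edges_cons, Walk.edges_nil, List.mem_cons, List.not_mem_nil, or_false]
      at h1 h2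
    rcases h1 with rfl | rfl <;> rcases h2 with rfl | rfl
    · rfl
    · exact absurd h3 key
    · exact absurd h3.symm key
    · rfl

theorem IsCompleteMultipartite.adj_iff_of_not_adj {V : Type*} {G : SimpleGraph V}
    (hG : G.IsCompleteMultipartite) {u v : V} (huv : ¬ G.Adj u v) (z : V) :
    G.Adj u z ↔ G.Adj v z := by
  constructor <;> intro h <;> by_contra h'
  · exact hG.trans _ _ _ huv h' h
  · exact hG.trans _ _ _ (fun h => huv h.symm) h' h

/-- In a complete multipartite graph with an edge, proper edge-colourings are rainbow
connected. -/
theorem IsCompleteMultipartite.isProperlyRainbowConnected {V K : Type*} {G : SimpleGraph V}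
    (hG : G.IsCompleteMultipartite) (hparts : ∃ u v : V, G.Adj u v) {c : G.edgeSet → K}
    (hc : IsProperEdgeColouring c) : IsProperlyRainbowConnected c := by
  refine ⟨hc, fun u v => ?_⟩
  by_cases huv : u = v
  · subst huv
    exact ⟨.nil, by simp, by simp⟩
  by_cases hadj : G.Adj u v
  · refine ⟨.cons hadj .nil, by simp [huv], ?_⟩
    rintro ⟨e, he⟩ ⟨e', he'⟩ h1 h2 -
    simp only [Walk.edges_cons, Walk.edges_nil, List.mem_cons, List.not_mem_nil, or_false]
      at h1 h2
    exact Subtype.ext (h1.trans h2.symm)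
  · obtain ⟨x, y, hxy⟩ := hparts
    obtain ⟨w, hw⟩ : ∃ w, G.Adj u w := by
      by_contra! h
      exact hG.trans _ _ _ (fun h' => h x h'.symm) (h y) hxy
    exact hc.exists_isRainbowPath_of_adj_adj huv hw ((hG.adj_iff_of_not_adj hadj w).1 hw).symm

variable {V : Type*} [Fintype V] [DecidableEq V] {G : SimpleGraph V} [DecidableRel G.Adj]

theorem IsProperEdgeColouring.degree_le {k : ℕ} {c : G.edgeSet → Fin k}
    (hc : IsProperEdgeColouring c) (v : V) : G.degree v ≤ k := by
  rw [← card_neighborFinset_eq_degree, ← Fintype.card_fin k, ← Finset.card_univ,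
    ← Finset.card_attach]
  refine Finset.card_le_card_of_injOn
    (fun u => c ⟨s(v, u.1), (G.mem_neighborFinset v u.1).1 u.2⟩) (fun _ _ => by simp) ?_
  intro a _ b _ hab
  by_contra hne
  refine hc _ _ (fun h => hne ?_) ⟨v, by simp, by simp⟩ hab
  exact Subtype.ext (Sym2.congr_right.1 (Subtype.ext_iff.1 h))

/-- Each colour class is a matching, so it covers an even number of vertices and misses at least one
when the order is odd. -/
theorem IsProperEdgeColouring.two_mul_card_le {k : ℕ} {c : G.edgeSet → Fin k}
    (hc : IsProperEdgeColouring c) (hodd : Odd (Fintype.card V)) :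
    2 * G.edgeFinset.card ≤ k * (Fintype.card V - 1) := by
  have hclass : ∀ i : Fin k, 2 * (univ.filter fun e => c e = i).card ≤ Fintype.card V - 1 := by
    intro i
    have h1 := Finset.sum_card_bipartiteAbove_eq_sum_card_bipartiteBelow
      (s := (univ : Finset V)) (t := univ.filter fun e => c e = i)
      (fun v (e : G.edgeSet) => v ∈ (e : Sym2 V))
    have h2 : ∀ e : G.edgeSet,
        (Finset.bipartiteBelow (fun v (e : G.edgeSet) => v ∈ (e : Sym2 V)) univ e).card = 2 := by
      rintro ⟨e, he⟩
      rw [← Sym2.card_toFinset_of_not_isDiag e (G.not_isDiag_of_mem_edgeSet he)]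
      congr 1
      ext v
      simp [Finset.bipartiteBelow]
    have h3 : ∀ v : V, (Finset.bipartiteAbove (fun v (e : G.edgeSet) => v ∈ (e : Sym2 V))
        (univ.filter fun e => c e = i) v).card ≤ 1 := by
      intro v
      rw [Finset.card_le_one]
      intro a ha b hb
      simp only [Finset.bipartiteAbove, mem_filter, mem_univ, true_and] at ha hb
      by_contra hne
      exact hc a b hne ⟨v, ha.2, hb.2⟩ (ha.1.trans hb.1.symm)
    simp_rw [h2] at h1
    have h4 := Finset.sum_le_sum fun v (_ : v ∈ univ) => h3 v
    rw [h1, Finset.sum_const, Finset.sum_const, Finset.card_univ] at h4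
    simp only [smul_eq_mul] at h4
    obtain ⟨l, hl⟩ := hodd
    omega
  have h1 : G.edgeFinset.card = ∑ i, (univ.filter fun e => c e = i).card := by
    rw [edgeFinset_card, ← Finset.card_univ, Finset.card_eq_sum_card_fiberwise (f := c) (t := univ)
      fun _ _ => by simp]
  rw [h1, Finset.mul_sum]
  refine (Finset.sum_le_sum fun i _ => hclass i).trans ?_
  simp

theorem degree_add_two_le {u v : V} (huv : u ≠ v) (h : ¬ G.Adj v u) :
    G.degree v + 2 ≤ Fintype.card V := by
  have h1 : G.neighborFinset v ⊆ (univ.erase v).erase u := fun z hz => by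
    rw [mem_neighborFinset] at hz
    refine Finset.mem_erase.2 ⟨?_, Finset.mem_erase.2 ⟨hz.ne', mem_univ z⟩⟩
    rintro rfl
    exact h hz
  have h2 := Finset.card_le_card h1
  rw [card_neighborFinset_eq_degree, Finset.card_erase_of_mem (by simp [huv]),
    Finset.card_erase_of_mem (mem_univ v), Finset.card_univ] at h2
  have h3 : 1 < Fintype.card V := Fintype.one_lt_card_iff.2 ⟨u, v, huv⟩
  omega

theorem exists_ne_not_adj {v : V} (h : G.degree v + 2 ≤ Fintype.card V) :
    ∃ u, u ≠ v ∧ ¬ G.Adj v u := by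
  obtain ⟨u, hu, hu'⟩ := Finset.exists_mem_notMem_of_card_lt_card
    (s := G.neighborFinset v) (t := univ.erase v) (by
      rw [Finset.card_erase_of_mem (mem_univ v), Finset.card_univ, card_neighborFinset_eq_degree]
      omega)
  exact ⟨u, Finset.ne_of_mem_erase hu, by simpa using hu'⟩

theorem IsCompleteMultipartite.exists_representatives {V : Type*} {G : SimpleGraph V}
    (hG : G.IsCompleteMultipartite) :
    ∃ ρ : V → V, (∀ v, ρ (ρ v) = ρ v) ∧ ∀ u v, ρ u = ρ v ↔ ¬ G.Adj u v := by
  refine ⟨fun v => (Quotient.mk hG.setoid v).out, fun v => ?_, fun u v => ?_⟩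
  · simp only [Quotient.out_eq]
  · rw [Quotient.out_inj]
    exact Quotient.eq

/-- Complete multipartite graphs all of whose parts have at least two vertices. -/
theorem IsCompleteMultipartite.exists_isProperEdgeColouring_of_nontrivial_parts
    (hG : G.IsCompleteMultipartite) {k : ℕ} (hpart : ∀ v, ∃ u, u ≠ v ∧ ¬ G.Adj v u)
    (hdeg : ∀ v, G.degree v ≤ k) (hk : k + 1 ≤ Fintype.card V)
    (hodd : Fintype.card V % 2 = 1 → k + 2 * G.edgeFinset.card ≤ Fintype.card V * k) :
    ∃ c : G.edgeSet → Fin k, IsProperEdgeColouring c := by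
  obtain ⟨ρ, hρ, hρG⟩ := hG.exists_representatives
  refine exists_isProperEdgeColouring_of_twinFibres hρ
    (fun u v z huv _ _ => hG.adj_iff_of_not_adj ((hρG u v).1 huv) z)
    (fun u v huv => by simpa using (hρG u v).not.1 huv) (fun v => ?_) hdeg (fun _ _ _ => hk) hodd
  obtain ⟨u, hu, huv⟩ := hpart v
  exact ⟨u, hu, (hρG u v).2 fun h => huv h.symm⟩

/-- All vertices form one clique fibre, so the amalgamation is a single vertex with loops. -/
theorem exists_isProperEdgeColouring_top {k : ℕ} (hk : k + 1 = Fintype.card V)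
    (hV : 2 ≤ Fintype.card V) (heven : Fintype.card V % 2 = 0) :
    ∃ c : (⊤ : SimpleGraph V).edgeSet → Fin k, IsProperEdgeColouring c := by
  obtain ⟨a, b, hab⟩ := Fintype.one_lt_card_iff.1 hV
  refine exists_isProperEdgeColouring_of_twinFibres (ρ := fun _ => a) (fun _ => rfl)
    (fun u v z _ hzu hzv => by simp [hzu.symm, hzv.symm]) (fun u v h => absurd rfl h) (fun v => ?_)
    (fun v => by rw [complete_graph_degree]; omega) (fun u v h => absurd rfl h) (fun h => by omega)
  by_cases h : v = a
  · exact ⟨b, h ▸ hab.symm, rfl⟩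
  · exact ⟨a, Ne.symm h, rfl⟩

/-- Complete multipartite graphs with at least two vertices adjacent to all others. -/
theorem IsCompleteMultipartite.exists_isProperEdgeColouring_of_two_universal
    (hG : G.IsCompleteMultipartite) {k : ℕ} {a b : V} (hab : a ≠ b) (ha : ∀ z, z ≠ a → G.Adj a z)
    (hb : ∀ z, z ≠ b → G.Adj b z) (hk : k + 1 = Fintype.card V)
    (hodd : Fintype.card V % 2 = 1 → k + 2 * G.edgeFinset.card ≤ Fintype.card V * k) :
    ∃ c : G.edgeSet → Fin k, IsProperEdgeColouring c := by
  classical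
  obtain ⟨ρ, hρ, hρG⟩ := hG.exists_representatives
  let Q : V → Prop := fun v => ∀ z, z ≠ v → G.Adj v z
  have hQ : ∀ u v, ρ u = ρ v → Q u → u = v := by
    intro u v huv hu
    by_contra hne
    exact (hρG u v).1 huv (hu v (Ne.symm hne))
  have hQρ : ∀ v, ¬ Q v → ¬ Q (ρ v) := fun v hv h =>
    hv (by have := hQ _ _ (hρ v) h; rwa [this] at h)
  -- The universal vertices would be singleton fibres; merged over `a` they form a clique fibre, of
  -- at least two vertices because of `b`.
  let ρ' : V → V := fun v => if Q v then a else ρ v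
  have h1 : ∀ v, Q v → ρ' v = a := fun v hv => if_pos hv
  have h0 : ∀ v, ¬ Q v → ρ' v = ρ v := fun v hv => if_neg hv
  have hmix : ∀ v, ¬ Q v → ρ v ≠ a := fun v hv h => hQρ v hv (by rw [h]; exact ha)
  refine exists_isProperEdgeColouring_of_twinFibres (ρ := ρ') (fun v => ?_) ?_ ?_ (fun v => ?_)
    (fun v => ?_) (fun _ _ _ => hk.le) hodd
  · by_cases hv : Q v
    · rw [h1 v hv, h1 a ha]
    · rw [h0 v hv, h0 _ (hQρ v hv), hρ]
  · intro u v z huv hzu hzv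
    by_cases hu : Q u <;> by_cases hv : Q v
    · exact iff_of_true (hu z hzu) (hv z hzv)
    · rw [h1 u hu, h0 v hv] at huv
      exact absurd huv.symm (hmix v hv)
    · rw [h0 u hu, h1 v hv] at huv
      exact absurd huv (hmix u hu)
    · rw [h0 u hu, h0 v hv] at huv
      exact hG.adj_iff_of_not_adj ((hρG u v).1 huv) z
  · intro u v huv
    have hne : u ≠ v := fun h => huv (by rw [h])
    by_cases hu : Q u
    · exact hu v hne.symm
    by_cases hv : Q v
    · exact (hv u hne).symm
    rw [h0 u hu, h0 v hv] at huv
    simpa using (hρG u v).not.1 huv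
  · by_cases hv : Q v
    · by_cases hva : v = a
      · exact ⟨b, by rw [hva]; exact hab.symm, by rw [h1 b hb, h1 v hv]⟩
      · exact ⟨a, Ne.symm hva, by rw [h1 a ha, h1 v hv]⟩
    · have hv' : ∃ z, z ≠ v ∧ ¬ G.Adj v z := by
        by_contra! h
        exact hv h
      obtain ⟨z, hzv, hz⟩ := hv'
      have hρz : ρ z = ρ v := (hρG z v).2 fun h => hz h.symm
      have hz' : ¬ Q z := fun h => hzv (hQ z v hρz h)
      exact ⟨z, hzv, by rw [h0 z hz', h0 v hv, hρz]⟩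
  · have := G.degree_lt_card_verts v
    omega

/-- Complete multipartite graphs of odd order with exactly one vertex adjacent to all others. -/
theorem IsCompleteMultipartite.exists_isProperEdgeColouring_of_unique_universal
    (hG : G.IsCompleteMultipartite) {k : ℕ} {a : V}
    (huniq : ∀ v, v ≠ a → ∃ u, u ≠ v ∧ ¬ G.Adj v u) (hk : k + 1 = Fintype.card V)
    (hodd : Fintype.card V % 2 = 1) :
    ∃ c : G.edgeSet → Fin k, IsProperEdgeColouring c := by
  classical
  -- `none` becomes a twin of `a`. The enlarged graph has even order, so the parity condition is
  -- void, all its parts are nontrivial, and its degrees are still at most `k`.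
  let f : Option V → V := fun o => o.getD a
  have hG' : (G.comap f).IsCompleteMultipartite :=
    ⟨fun _ _ _ h1 h2 h3 => hG.trans _ _ _ h1 h2 h3⟩
  have hpart : ∀ o, ∃ o', o' ≠ o ∧ ¬ (G.comap f).Adj o o' := by
    rintro (_ | v)
    · exact ⟨some a, by simp, by simp [f]⟩
    · by_cases hv : v = a
      · exact ⟨none, by simp, by simp [f, hv]⟩
      · obtain ⟨u, hu, huv⟩ := huniq v hv
        exact ⟨some u, by simpa using hu, by simpa [f] using huv⟩
  have hcard : Fintype.card (Option V) = Fintype.card V + 1 := Fintype.card_option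
  obtain ⟨c, hc⟩ := hG'.exists_isProperEdgeColouring_of_nontrivial_parts (k := k) hpart
    (fun o => by
      obtain ⟨o', h1, h2⟩ := hpart o
      have := degree_add_two_le h1 h2
      omega) (by omega) (fun h => by omega)
  exact hc.exists_of_injective (Option.some_injective V) fun u v h => by simpa [f] using h

theorem IsCompleteMultipartite.exists_isProperEdgeColouring_maxDegree
    (hG : G.IsCompleteMultipartite) (hparts : ∃ u v : V, G.Adj u v)
    (hodd : Fintype.card V % 2 = 1 →
      G.maxDegree + 2 * G.edgeFinset.card ≤ Fintype.card V * G.maxDegree) :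
    ∃ c : G.edgeSet → Fin G.maxDegree, IsProperEdgeColouring c := by
  obtain ⟨u, v, huv⟩ := hparts
  have : Nonempty V := ⟨u⟩
  have hV : 2 ≤ Fintype.card V := Fintype.one_lt_card_iff.2 ⟨u, v, huv.ne⟩
  have hlt := G.maxDegree_lt_card_verts
  by_cases hΔ : G.maxDegree + 2 ≤ Fintype.card V
  · exact hG.exists_isProperEdgeColouring_of_nontrivial_parts
      (fun v => exists_ne_not_adj (by have := G.degree_le_maxDegree v; omega))
      G.degree_le_maxDegree (by omega) hodd
  have hk : G.maxDegree + 1 = Fintype.card V := by omega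
  rcases Nat.mod_two_eq_zero_or_one (Fintype.card V) with heven | hodd'
  · obtain ⟨c, hc⟩ := exists_isProperEdgeColouring_top hk hV heven
    exact hc.exists_of_injective Function.injective_id fun u v h => h.ne
  · obtain ⟨a, ha⟩ := G.exists_maximal_degree_vertex
    have hauniv : ∀ z, z ≠ a → G.Adj a z := by
      intro z hz
      by_contra h
      have := degree_add_two_le hz h
      omega
    by_cases hb : ∃ b, b ≠ a ∧ ∀ z, z ≠ b → G.Adj b z
    · obtain ⟨b, hba, hb⟩ := hb
      exact hG.exists_isProperEdgeColouring_of_two_universal hba.symm hauniv hb hk hodd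
    · push Not at hb
      exact hG.exists_isProperEdgeColouring_of_unique_universal hb hk hodd'

theorem IsCompleteMultipartite.exists_isProperEdgeColouring_maxDegree_add_one
    (hG : G.IsCompleteMultipartite) (hparts : ∃ u v : V, G.Adj u v)
    (hodd : Fintype.card V % 2 = 1) :
    ∃ c : G.edgeSet → Fin (G.maxDegree + 1), IsProperEdgeColouring c := by
  obtain ⟨u, v, huv⟩ := hparts
  have : Nonempty V := ⟨u⟩
  have hlt := G.maxDegree_lt_card_verts
  by_cases hΔ : G.maxDegree + 2 ≤ Fintype.card V
  · refine hG.exists_isProperEdgeColouring_of_nontrivial_parts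
      (fun v => exists_ne_not_adj (by have := G.degree_le_maxDegree v; omega))
      (fun v => (G.degree_le_maxDegree v).trans (Nat.le_succ _)) (by omega) fun _ => ?_
    have h1 : 2 * G.edgeFinset.card ≤ Fintype.card V * G.maxDegree := by
      rw [← G.sum_degrees_eq_twice_card_edges, ← smul_eq_mul, ← Finset.card_univ,
        ← Finset.sum_const]
      exact Finset.sum_le_sum fun v _ => G.degree_le_maxDegree v
    rw [Nat.mul_succ]
    omega
  · have hcard : Fintype.card (Option V) = Fintype.card V + 1 := Fintype.card_option
    -- Here Δ + 1 = n, and the complete graph on n + 1 vertices, of even order, needs just n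
    -- colours.
    obtain ⟨c, hc⟩ := exists_isProperEdgeColouring_top (V := Option V) (k := G.maxDegree + 1)
      (by omega) (by omega) (by omega)
    exact hc.exists_of_injective (Option.some_injective V) fun u v h => by simpa using h.ne

theorem prc_eq_of_forall_le {V : Type*} {G : SimpleGraph V} {k : ℕ} {c : G.edgeSet → Fin k}
    (hc : IsProperlyRainbowConnected c)
    (hle : ∀ (l : ℕ) (c : G.edgeSet → Fin l), IsProperEdgeColouring c → k ≤ l) : G.prc = k := by
  refine le_antisymm (Nat.sInf_le ⟨c, hc⟩) (le_csInf ⟨k, c, hc⟩ ?_)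
  rintro l ⟨c', hc'⟩
  exact hle l c' hc'.1

theorem isOverfull_iff [Nonempty V] : G.IsOverfull ↔ Odd (Fintype.card V) ∧
    G.maxDegree * (Fintype.card V - 1) < 2 * G.edgeFinset.card := by
  have h : 1 ≤ Fintype.card V := Fintype.card_pos
  have h2 : (G.edgeFinset.card : ℚ) > 1 / 2 * (G.maxDegree : ℚ) * ((Fintype.card V : ℚ) - 1) ↔
      G.maxDegree * (Fintype.card V - 1) < 2 * G.edgeFinset.card := by
    rw [← Nat.cast_lt (α := ℚ)]
    push_cast [Nat.cast_sub h]
    constructor <;> intro h <;> linarith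
  rw [IsOverfull, h2]

end SimpleGraph

end

/-- The hypothesis `hparts` says that the complete multipartite graph `G`, whose parts are the
classes of pairwise non-adjacent vertices, has at least two parts. -/
theorem mainTheorem5 {V : Type*} [Fintype V] [DecidableEq V] (G : SimpleGraph V)
    [DecidableRel G.Adj] (hG : G.IsCompleteMultipartite) (hparts : ∃ u v : V, G.Adj u v) :
    (G.IsOverfull → G.prc = G.maxDegree + 1) ∧ (¬ G.IsOverfull → G.prc = G.maxDegree) := by
  have : Nonempty V := ⟨hparts.choose⟩
  have hV : 1 ≤ Fintype.card V := Fintype.card_pos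
  rw [SimpleGraph.isOverfull_iff]
  constructor
  · rintro ⟨hodd, hm⟩
    obtain ⟨c, hc⟩ := hG.exists_isProperEdgeColouring_maxDegree_add_one hparts
      (Nat.odd_iff.1 hodd)
    refine SimpleGraph.prc_eq_of_forall_le (hG.isProperlyRainbowConnected hparts hc)
      fun l c' hc' => ?_
    -- Overfullness gives Δ(n - 1) < 2m ≤ l(n - 1), hence Δ < l.
    exact lt_of_mul_lt_mul_right (hm.trans_le (hc'.two_mul_card_le hodd)) (Nat.zero_le _)
  · intro h
    obtain ⟨c, hc⟩ := hG.exists_isProperEdgeColouring_maxDegree hparts fun hodd => by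
      have h1 : 2 * G.edgeFinset.card ≤ G.maxDegree * (Fintype.card V - 1) :=
        not_lt.1 fun h' => h ⟨Nat.odd_iff.2 hodd, h'⟩
      obtain ⟨n, hn⟩ := Nat.exists_eq_add_of_le hV
      rw [hn, Nat.add_sub_cancel_left] at h1
      rw [hn, add_mul, one_mul, mul_comm n]
      omega
    refine SimpleGraph.prc_eq_of_forall_le (hG.isProperlyRainbowConnected hparts hc)
      fun l c' hc' => ?_
    obtain ⟨v, hv⟩ := G.exists_maximal_degree_vertex
    exact hv ▸ hc'.degree_le v
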